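/- All Hilbert spaces are finite-dimensional. A rank-one quantum game $G=G(|\psi\rangle,|\gamma\rangle)$ is given by Hilbert spaces $\mathcal H_A,\mathcal H_B,\mathcal H_C$ and unit vectors $|\psi\rangle,|\gamma\rangle\in\mathcal H_A\otimes\mathcal H_B\otimes\mathcal H_C$: a referee prepares $|\psi\rangle$, sends the registers $A$ and $B$ to Alice and Bob respectively, receives these registers back, and accepts with the probability that the projective measurement $\{|\gamma\rangle\langle\gamma|,\,1-|\gamma\rangle\langle\gamma|\}$ of $ABC$ yields the outcome $|\gamma\rangle\langle\gamma|$. A quantum operation is a completely positive trace-preserving linear map. The entangled value with one-way communication is $$\omega_{qow}(G)=\sup\ \mathrm{tr}\Big(\big(|\gamma\rangle\langle\gamma|\otimes 1_{A'}\big)\,(T_{BA'}\otimes \mathrm{id}_{AC})\,(T_{AA'}\otimes\mathrm{id}_{BC})\big(|\psi\rangle\langle\psi|\otimes|0\rangle\langle0|_{A'}\big)\Big),$$ where the supremum is over all (nonzero) finite-dimensional auxiliary spaces $\mathcal H_{A'}$ with a fixed unit vector $|0\rangle$ and all quantum operations $T_{AA'}$ on $B(\mathcal H_A\otimes\mathcal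 H_{A'})$ and $T_{BA'}$ on $B(\mathcal H_B\otimes\mathcal H_{A'})$. The maximal value $V(G)$ is the optimal winning probability of a single player holding both $A$ and $B$, $$V(G)=\sup\ \mathrm{tr}\Big(\big(|\gamma\rangle\langle\gamma|\otimes 1_{E}\big)\,(W_{ABE}\otimes\mathrm{id}_C)\big(|\psi\rangle\langle\psi|\otimes|0\rangle\langle0|_{E}\big)\Big),$$ where the supremum is over all (nonzero) finite-dimensional $\mathcal H_E$ with a fixed unit vector $|0\rangle$ and all quantum operations $W_{ABE}$ on $B(\mathcal H_A\otimes\mathcal H_B\otimes\mathcal H_E)$. The $k$-fold parallel repetition $G^k$ is the rank-one quantum game $G(|\psi\rangle^{\otimes k},|\gamma\rangle^{\otimes k})$ with registers $\mathcal H_A^{\otimes k},\mathcal H_B^{\otimes k},\mathcal H_C^{\otimes k}$. **Theorem.** For every rank-one quantum game $G$ and every $k\in\mathbb N$: 1. $V(G)=\big\|\mathrm{tr}_C|\psi\rangle\langle\gamma|\big\|_{S_1(\mathcal H_A\otimes\mathcal H_B)}^2$ (the squared trace norm), and $V(G^k)=V(G)^k$; 2. $\omega_{qow}(G^k)=\omega_{qow}(G)^k$.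 -/

import Mathlib

open scoped Kronecker ComplexOrder

noncomputable section

/-! Finite-dimensional Hilbert spaces are `ℂ^A` with its Hilbert norm, for a finite type `A` that
labels an orthonormal basis; the tensor product of `ℂ^A` and `ℂ^B` is `ℂ^(A × B)`. -/

/-- `|x⟩⟨y|`. -/
def ketBra {n : Type*} (x y : EuclideanSpace ℂ n) : Matrix n n ℂ :=
  Matrix.vecMulVec (fun i => x i) (fun j => star (y j))

/-- The map `T ⊗ id_R` on `B(ℂ^n ⊗ ℂ^R)`. -/
def ampliation {n R : Type*} (T : Matrix n n ℂ →ₗ[ℂ] Matrix n n ℂ)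
    (X : Matrix (n × R) (n × R) ℂ) : Matrix (n × R) (n × R) ℂ :=
  Matrix.of fun p q => T (Matrix.of fun i j => X (i, p.2) (j, q.2)) p.1 q.1

/-- Quantum operations (channels): completely positive and trace preserving linear maps. -/
structure IsQuantumOperation {n : Type*} [Fintype n]
    (T : Matrix n n ℂ →ₗ[ℂ] Matrix n n ℂ) : Prop where
  trace_preserving : ∀ X : Matrix n n ℂ, (T X).trace = X.trace
  completely_positive : ∀ (m : ℕ) (X : Matrix (n × Fin m) (n × Fin m) ℂ),
    X.PosSemidef → (ampliation T X).PosSemidef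

/-- Apply `T`, which acts on the registers `n`, to a state on registers `Y` that split as `n`
together with a rest `R` (on which the identity acts). -/
def applyOn {Y n R : Type*} (e : Y ≃ n × R) (T : Matrix n n ℂ →ₗ[ℂ] Matrix n n ℂ)
    (ρ : Matrix Y Y ℂ) : Matrix Y Y ℂ :=
  (ampliation T (ρ.reindex e e)).reindex e.symm e.symm

/-- Select the registers `A` and `E` out of `A, B, C, E`. -/
def registersAE (A B C E : Type*) : (A × B × C) × E ≃ (A × E) × (B × C) where
  toFun x := ((x.1.1, x.2), x.1.2)
  invFun y := ((y.1.1, y.2), y.1.2)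
  left_inv _ := rfl
  right_inv _ := rfl

/-- Select the registers `B` and `E` out of `A, B, C, E`. -/
def registersBE (A B C E : Type*) : (A × B × C) × E ≃ (B × E) × (A × C) where
  toFun x := ((x.1.2.1, x.2), (x.1.1, x.1.2.2))
  invFun y := ((y.2.1, y.1.1, y.2.2), y.1.2)
  left_inv _ := rfl
  right_inv _ := rfl

/-- Select the registers `A`, `B` and `E` out of `A, B, C, E`. -/
def registersABE (A B C E : Type*) : (A × B × C) × E ≃ (A × B × E) × C where
  toFun x := ((x.1.1, x.1.2.1, x.2), x.1.2.2)
  invFun y := ((y.1.1, y.1.2.1, y.2), y.1.2.2)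
  left_inv _ := rfl
  right_inv _ := rfl

/-- A rank-one quantum game: the referee prepares the state `ψ`, sends the registers `A` and `B`
to the players, keeps `C`, and finally measures the returned registers together with `C` against
the state `γ`. -/
structure RankOneGame (A B C : Type*) [Fintype A] [Fintype B] [Fintype C] where
  ψ : EuclideanSpace ℂ (A × B × C)
  γ : EuclideanSpace ℂ (A × B × C)
  norm_ψ : ‖ψ‖ = 1
  norm_γ : ‖γ‖ = 1

/-- The `k`-fold tensor power of a vector, with the registers of the `k` copies grouped together. -/
def tensorPower {A B C : Type*} (ψ : EuclideanSpace ℂ (A × B × C)) (k : ℕ) :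
    EuclideanSpace ℂ ((Fin k → A) × (Fin k → B) × (Fin k → C)) :=
  WithLp.toLp 2 fun x => ∏ i, ψ (x.1 i, x.2.1 i, x.2.2 i)

theorem norm_tensorPower {A B C : Type*} [Fintype A] [Fintype B] [Fintype C]
    (ψ : EuclideanSpace ℂ (A × B × C)) (k : ℕ) : ‖tensorPower ψ k‖ = ‖ψ‖ ^ k := by
  classical
  have h : ‖tensorPower ψ k‖ ^ 2 = (‖ψ‖ ^ k) ^ 2 := by
    rw [EuclideanSpace.norm_sq_eq, ← pow_mul, mul_comm, pow_mul, EuclideanSpace.norm_sq_eq]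
    let e : (Fin k → A × B × C) ≃ (Fin k → A) × (Fin k → B) × (Fin k → C) :=
      { toFun := fun f => (fun i => (f i).1, fun i => (f i).2.1, fun i => (f i).2.2)
        invFun := fun x i => (x.1 i, x.2.1 i, x.2.2 i)
        left_inv := fun _ => rfl
        right_inv := fun _ => rfl }
    rw [← e.sum_comp]
    have h1 : ∀ f : Fin k → A × B × C, ‖tensorPower ψ k (e f)‖ ^ 2 = ∏ i, ‖ψ (f i)‖ ^ 2 := by
      intro f
      simp [tensorPower, e, Finset.prod_pow]
    simp_rw [h1]
    exact (Fintype.sum_pow (fun x => ‖ψ x‖ ^ 2) k).symm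
  exact (sq_eq_sq₀ (norm_nonneg _) (by positivity)).1 h

namespace RankOneGame

variable {A B C : Type*} [Fintype A] [Fintype B] [Fintype C]

/-- The `k`-fold parallel repetition `G^k`. -/
def parallel (G : RankOneGame A B C) (k : ℕ) :
    RankOneGame (Fin k → A) (Fin k → B) (Fin k → C) where
  ψ := tensorPower G.ψ k
  γ := tensorPower G.γ k
  norm_ψ := by rw [norm_tensorPower, G.norm_ψ, one_pow]
  norm_γ := by rw [norm_tensorPower, G.norm_γ, one_pow]

/-- The initial global state `|ψ⟩⟨ψ| ⊗ |0⟩⟨0|`, with an auxiliary system of dimension `d + 1`. -/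
def initialState (G : RankOneGame A B C) (d : ℕ) :
    Matrix ((A × B × C) × Fin (d + 1)) ((A × B × C) × Fin (d + 1)) ℂ :=
  ketBra G.ψ G.ψ ⊗ₖ ketBra (EuclideanSpace.single 0 1) (EuclideanSpace.single 0 1)

/-- The probability `tr((|γ⟩⟨γ| ⊗ 1) ρ)` that the referee accepts the final global state `ρ`. -/
def winProb (G : RankOneGame A B C) {d : ℕ}
    (ρ : Matrix ((A × B × C) × Fin (d + 1)) ((A × B × C) × Fin (d + 1)) ℂ) : ℝ :=
  ((ketBra G.γ G.γ ⊗ₖ (1 : Matrix (Fin (d + 1)) (Fin (d + 1)) ℂ)) * ρ).trace.re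

/-- The entangled value with one-way communication: Alice acts on `A` and the auxiliary system,
then sends the latter to Bob, who acts on `B` and the auxiliary system. -/
def oneWayValue (G : RankOneGame A B C) : ℝ :=
  sSup {p : ℝ | ∃ (d : ℕ)
    (T : Matrix (A × Fin (d + 1)) (A × Fin (d + 1)) ℂ →ₗ[ℂ]
      Matrix (A × Fin (d + 1)) (A × Fin (d + 1)) ℂ)
    (S : Matrix (B × Fin (d + 1)) (B × Fin (d + 1)) ℂ →ₗ[ℂ]
      Matrix (B × Fin (d + 1)) (B × Fin (d + 1)) ℂ),
    IsQuantumOperation T ∧ IsQuantumOperation S ∧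
      p = G.winProb (applyOn (registersBE A B C (Fin (d + 1))) S
        (applyOn (registersAE A B C (Fin (d + 1))) T (G.initialState d)))}

/-- The maximal value: the optimal winning probability of a single player who has access to both
`A` and `B` and to an auxiliary system. -/
def maximalValue (G : RankOneGame A B C) : ℝ :=
  sSup {p : ℝ | ∃ (d : ℕ)
    (W : Matrix (A × B × Fin (d + 1)) (A × B × Fin (d + 1)) ℂ →ₗ[ℂ]
      Matrix (A × B × Fin (d + 1)) (A × B × Fin (d + 1)) ℂ),
    IsQuantumOperation W ∧
      p = G.winProb (applyOn (registersABE A B C (Fin (d + 1))) W (G.initialState d))}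

/-- The matrix `M_AB = tr_C |ψ⟩⟨γ|`. -/
def gameMatrix (G : RankOneGame A B C) : Matrix (A × B) (A × B) ℂ :=
  Matrix.of fun p q => ∑ c, ketBra G.ψ G.γ (p.1, p.2, c) (q.1, q.2, c)

end RankOneGame

/-- The trace norm (norm of `S_1`): the sum of the singular values, i.e. of the square roots of
the eigenvalues of `Mᴴ M`. -/
def traceNorm {n : Type*} [Fintype n] [DecidableEq n] (M : Matrix n n ℂ) : ℝ :=
  ∑ i, √((Matrix.isHermitian_conjTranspose_mul_self M).eigenvalues i)

end

/-!
Write `M = tr_C |ψ⟩⟨γ|`. Expanding channels into Kraus operators turns every winning probability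
into a sum of squares `∑ |tr (M X)|²`. For a single player the `X` are the blocks of an isometry on
`A ⊗ B`, and the optimum is the squared trace norm of `M`. For two players with one-way
communication they have the form `∑ₑ Vₑ ⊗ Rₑ` with a column `(Vₑ)` of Alice's blocks and a row
`(Rₑ)` of Bob's blocks, and the optimum is the squared norm of `M` as a functional on the Haagerup
tensor product.

The matrix `M` of `G^k` is the `k`-th tensor power of that of `G`, so it remains to see that both
norms are multiplicative. For the trace norm this is the uniqueness of positive square roots. For
the Haagerup norm, tensor powers of columns and rows give `≥`, while `≤` follows by duality: Sion's
minimax theorem provides an optimal certificate consisting of positive semidefinite matrices, and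
tensor powers of certificates are certificates.
-/

noncomputable section

open Matrix

/-! ### Positive semidefinite matrices -/

section PosSemidef

variable {n : Type*} [Fintype n]

theorem exists_eq_conjTranspose_mul_self {X : Matrix n n ℂ} (hX : X.PosSemidef) :
    ∃ L : Matrix n n ℂ, X = Lᴴ * L := by
  classical
  open scoped MatrixOrder in
  exact CStarAlgebra.nonneg_iff_eq_star_mul_self.1 hX.nonneg

theorem trace_mul_nonneg_of_posSemidef {X Y : Matrix n n ℂ} (hX : X.PosSemidef)
    (hY : Y.PosSemidef) : 0 ≤ (X * Y).trace := by
  obtain ⟨L, rfl⟩ := exists_eq_conjTranspose_mul_self hX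
  rw [Matrix.mul_assoc, Matrix.trace_mul_comm]
  exact (hY.mul_mul_conjTranspose_same L).trace_nonneg

theorem trace_conjTranspose_mul_self_eq_sum {m : Type*} [Fintype m] (X : Matrix m n ℂ) :
    (Xᴴ * X).trace = ((∑ j, ∑ i, ‖X i j‖ ^ 2 : ℝ) : ℂ) := by
  simp [Matrix.trace, Matrix.mul_apply, Complex.conj_mul']

theorem trace_mul_conjTranspose_mul_self_eq_sum {m : Type*} [Fintype m] (H : Matrix n n ℂ)
    (L : Matrix m n ℂ) :
    (H * (Lᴴ * L)).trace = ∑ l, star (star (L l)) ⬝ᵥ (H *ᵥ star (L l)) := by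
  rw [← Matrix.mul_assoc, trace_mul_comm]
  simp only [Matrix.trace, diag, Matrix.mul_apply, dotProduct, mulVec, star_star,
    conjTranspose_apply, Pi.star_apply]

/-- Density matrices: positive semidefinite matrices of trace one. -/
def densityMatrices (n : Type*) [Fintype n] : Set (Matrix n n ℂ) :=
  {ρ | ρ.PosSemidef ∧ ρ.trace = 1}

theorem convex_densityMatrices : Convex ℝ (densityMatrices n) := by
  intro ρ hρ σ hσ a b ha hb hab
  refine ⟨(hρ.1.smul ha).add (hσ.1.smul hb), ?_⟩
  rw [trace_add, trace_smul, trace_smul, hρ.2, hσ.2, ← add_smul, hab, one_smul]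

theorem isCompact_densityMatrices : IsCompact (densityMatrices n) := by
  have himage : densityMatrices n =
      (fun L : Matrix n n ℂ => Lᴴ * L) '' {L | (Lᴴ * L).trace = 1} := by
    ext ρ
    constructor
    · rintro ⟨hρ, htr⟩
      obtain ⟨L, rfl⟩ := exists_eq_conjTranspose_mul_self hρ
      exact ⟨L, htr, rfl⟩
    · rintro ⟨L, hL, rfl⟩
      exact ⟨posSemidef_conjTranspose_mul_self L, hL⟩
  have hbox : IsCompact (Set.univ.pi fun _ : n => Set.univ.pi fun _ : n =>
      Metric.closedBall (0 : ℂ) 1) :=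
    isCompact_univ_pi fun _ => isCompact_univ_pi fun _ => isCompact_closedBall _ _
  rw [himage]
  refine IsCompact.image (hbox.of_isClosed_subset (isClosed_eq (by fun_prop) (by fun_prop)) ?_)
    (by fun_prop)
  intro L hL i _ j _
  have hsum : ∑ j, ∑ i, ‖L i j‖ ^ 2 = 1 := by
    exact_mod_cast (trace_conjTranspose_mul_self_eq_sum L).symm.trans hL
  have hentry : ‖L i j‖ ^ 2 ≤ 1 := hsum ▸
    (Finset.single_le_sum (f := fun i => ‖L i j‖ ^ 2) (fun _ _ => by positivity)
      (Finset.mem_univ i)).trans (Finset.single_le_sum (f := fun j => ∑ i, ‖L i j‖ ^ 2)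
      (fun _ _ => by positivity) (Finset.mem_univ j))
  simpa using (sq_le_one_iff₀ (norm_nonneg _)).1 hentry

theorem inv_trace_smul_mem_densityMatrices {X : Matrix n n ℂ} (hX : X.PosSemidef) (h0 : X ≠ 0) :
    0 < X.trace.re ∧ X.trace.re⁻¹ • X ∈ densityMatrices n := by
  obtain ⟨hre, him⟩ := Complex.nonneg_iff.1 hX.trace_nonneg
  have htr : X.trace = X.trace.re := Complex.ext rfl him.symm
  have hne : X.trace.re ≠ 0 := by
    intro hzero
    obtain ⟨L, rfl⟩ := exists_eq_conjTranspose_mul_self hX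
    rw [hzero, Complex.ofReal_zero, trace_conjTranspose_mul_self_eq_zero_iff] at htr
    exact h0 (by rw [htr, Matrix.mul_zero])
  refine ⟨hre.lt_of_ne' hne, hX.smul (inv_nonneg.2 hre), ?_⟩
  rw [trace_smul, htr, Complex.ofReal_re, Complex.real_smul, ← Complex.ofReal_mul,
    inv_mul_cancel₀ hne, Complex.ofReal_one]

theorem nonempty_densityMatrices [Nonempty n] : (densityMatrices n).Nonempty := by
  classical
  exact ⟨_, (inv_trace_smul_mem_densityMatrices (X := (1 : Matrix n n ℂ)) PosSemidef.one
    one_ne_zero).2⟩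

theorem posSemidef_of_forall_densityMatrices {H : Matrix n n ℂ} (hH : H.IsHermitian)
    (h : ∀ ρ ∈ densityMatrices n, 0 ≤ (H * ρ).trace.re) : H.PosSemidef := by
  refine PosSemidef.of_dotProduct_mulVec_nonneg hH fun x =>
    Complex.nonneg_iff.2 ⟨?_, (hH.im_star_dotProduct_mulVec_self x).symm⟩
  obtain rfl | hx := eq_or_ne x 0
  · simp
  obtain ⟨htr, hρ⟩ := inv_trace_smul_mem_densityMatrices (posSemidef_vecMulVec_self_star x)
    (by simpa [vecMulVec_eq_zero] using hx)
  have hquad := h _ hρ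
  rw [Matrix.mul_smul, trace_smul, mul_vecMulVec, trace_vecMulVec (H *ᵥ x),
    dotProduct_comm, Complex.smul_re, smul_eq_mul] at hquad
  exact (mul_nonneg_iff_of_pos_left (inv_pos.2 htr)).1 hquad

/-- The coefficient of `1` is the largest eigenvalue of `X`. -/
theorem exists_densityMatrix_trace_smul_one_sub_posSemidef [DecidableEq n] [Nonempty n]
    {X : Matrix n n ℂ} (hX : X.IsHermitian) :
    ∃ ρ ∈ densityMatrices n, ((X * ρ).trace.re • (1 : Matrix n n ℂ) - X).PosSemidef := by
  obtain ⟨ρ, hρ, hmax⟩ := isCompact_densityMatrices.exists_isMaxOn nonempty_densityMatrices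
    (f := fun ρ : Matrix n n ℂ => (X * ρ).trace.re) (by fun_prop)
  refine ⟨ρ, hρ, posSemidef_of_forall_densityMatrices
    ((isHermitian_one.smul (.all _)).sub hX) fun σ hσ => ?_⟩
  have hle : (X * σ).trace.re ≤ (X * ρ).trace.re := hmax hσ
  simpa [Matrix.sub_mul, hσ.2] using hle

end PosSemidef

/-! ### Tensor powers -/

section piKronecker

variable {ι l m n R : Type*} [Fintype ι] [CommSemiring R]

/-- The tensor product of a finite family of matrices, the analogue of `Matrix.kronecker` for an
arbitrary number of factors. -/
def piKronecker (V : ι → Matrix m n R) : Matrix (ι → m) (ι → n) R :=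
  Matrix.of fun f g => ∏ i, V i (f i) (g i)

@[simp]
theorem piKronecker_apply (V : ι → Matrix m n R) (f : ι → m) (g : ι → n) :
    piKronecker V f g = ∏ i, V i (f i) (g i) := rfl

theorem piKronecker_mul [DecidableEq ι] [Fintype m] (V : ι → Matrix l m R)
    (W : ι → Matrix m n R) :
    piKronecker V * piKronecker W = piKronecker fun i => V i * W i := by
  ext f g
  simp only [Matrix.mul_apply, piKronecker_apply, Fintype.prod_sum, Finset.prod_mul_distrib]

theorem conjTranspose_piKronecker [StarRing R] (V : ι → Matrix m n R) :
    (piKronecker V)ᴴ = piKronecker fun i => (V i)ᴴ := by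
  ext f g
  simp

theorem piKronecker_one [DecidableEq n] :
    piKronecker (fun _ : ι => (1 : Matrix n n R)) = 1 := by
  ext f g
  simp [Matrix.one_apply, Finset.prod_ite_zero, funext_iff]

theorem trace_piKronecker [DecidableEq ι] [Fintype n] (V : ι → Matrix n n R) :
    (piKronecker V).trace = ∏ i, (V i).trace := by
  simp only [Matrix.trace, Matrix.diag, piKronecker_apply, Fintype.prod_sum]

theorem sum_piKronecker [DecidableEq ι] {κ : Type*} [Fintype κ] (V : ι → κ → Matrix m n R) :
    ∑ s : ι → κ, piKronecker (fun i => V i (s i)) = piKronecker fun i => ∑ e, V i e := by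
  ext f g
  simp only [Matrix.sum_apply, piKronecker_apply, Fintype.prod_sum]

theorem posSemidef_piKronecker [Finite n] {V : ι → Matrix n n ℂ}
    (hV : ∀ i, (V i).PosSemidef) : (piKronecker V).PosSemidef := by
  classical
  have := Fintype.ofFinite n
  choose L hL using fun i => exists_eq_conjTranspose_mul_self (hV i)
  rw [show V = fun i => (L i)ᴴ * L i from funext hL, ← piKronecker_mul,
    ← conjTranspose_piKronecker]
  exact posSemidef_conjTranspose_mul_self _

end piKronecker

section bipartitePow

variable {A B : Type*}

/-- The `k`-th tensor power of an operator on `ℂ^A ⊗ ℂ^B`, as an operator on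
`(ℂ^A)^{⊗k} ⊗ (ℂ^B)^{⊗k}`. -/
def bipartitePow (M : Matrix (A × B) (A × B) ℂ) (k : ℕ) :
    Matrix ((Fin k → A) × (Fin k → B)) ((Fin k → A) × (Fin k → B)) ℂ :=
  (piKronecker fun _ : Fin k => M).submatrix (Equiv.arrowProdEquivProdArrow _ _ _).symm
    (Equiv.arrowProdEquivProdArrow _ _ _).symm

theorem bipartitePow_apply (M : Matrix (A × B) (A × B) ℂ) (k : ℕ)
    (f f' : Fin k → A) (g g' : Fin k → B) :
    bipartitePow M k (f, g) (f', g') = ∏ i, M (f i, g i) (f' i, g' i) := rfl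

theorem trace_bipartitePow_mul_kronecker [Fintype A] [Fintype B] (M : Matrix (A × B) (A × B) ℂ)
    {k : ℕ} (V : Fin k → Matrix A A ℂ) (W : Fin k → Matrix B B ℂ) :
    (bipartitePow M k * (piKronecker V ⊗ₖ piKronecker W)).trace =
      ∏ i, (M * (V i ⊗ₖ W i)).trace := by
  have hregroup : piKronecker V ⊗ₖ piKronecker W =
      (piKronecker fun i => V i ⊗ₖ W i).submatrix (Equiv.arrowProdEquivProdArrow _ _ _).symm
        (Equiv.arrowProdEquivProdArrow _ _ _).symm := by
    ext ⟨f, g⟩ ⟨f', g'⟩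
    simp [Equiv.arrowProdEquivProdArrow, Finset.prod_mul_distrib]
  rw [hregroup, bipartitePow, submatrix_mul_equiv, piKronecker_mul, ← trace_piKronecker]
  exact Equiv.sum_comp _ fun i => (piKronecker fun i => M * V i ⊗ₖ W i) i i

end bipartitePow

/-! ### Kraus families -/

section Kraus

variable {ι n : Type*} [Fintype n]

/-- The normalization of the Kraus operators of a trace preserving map. Equivalently, the `K i`
are the blocks of an isometry. -/
def IsKrausFamily {m : Type*} [Fintype ι] [Fintype m] [DecidableEq n]
    (K : ι → Matrix m n ℂ) : Prop :=
  ∑ i, (K i)ᴴ * K i = 1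

/-- The completely positive map with Kraus operators `K i`. -/
def krausMap [Fintype ι] (K : ι → Matrix n n ℂ) : Matrix n n ℂ →ₗ[ℂ] Matrix n n ℂ where
  toFun X := ∑ i, K i * X * (K i)ᴴ
  map_add' X Y := by simp only [Matrix.mul_add, Matrix.add_mul, Finset.sum_add_distrib]
  map_smul' c X := by
    simp only [Matrix.mul_smul, Matrix.smul_mul, Finset.smul_sum, RingHom.id_apply]

theorem krausMap_apply [Fintype ι] (K : ι → Matrix n n ℂ) (X : Matrix n n ℂ) :
    krausMap K X = ∑ i, K i * X * (K i)ᴴ := rfl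

theorem ampliation_krausMap [Fintype ι] {R : Type*} [Fintype R] [DecidableEq R]
    (K : ι → Matrix n n ℂ) (X : Matrix (n × R) (n × R) ℂ) :
    ampliation (krausMap K) X =
      ∑ i, (K i ⊗ₖ (1 : Matrix R R ℂ)) * X * (K i ⊗ₖ (1 : Matrix R R ℂ))ᴴ := by
  ext ⟨p, r⟩ ⟨q, s⟩
  simp [ampliation, krausMap_apply, Matrix.sum_apply, Matrix.mul_apply, Fintype.sum_prod_type,
    Matrix.one_apply, ite_mul, apply_ite]

theorem trace_krausMap [Fintype ι] (K : ι → Matrix n n ℂ) (X : Matrix n n ℂ) :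
    (krausMap K X).trace = ((∑ i, (K i)ᴴ * K i) * X).trace := by
  simp_rw [krausMap_apply, trace_sum, Finset.sum_mul, trace_sum, trace_mul_cycle (K _) X]

theorem IsKrausFamily.isQuantumOperation_krausMap [Fintype ι] [DecidableEq n]
    {K : ι → Matrix n n ℂ} (hK : IsKrausFamily K) : IsQuantumOperation (krausMap K) where
  trace_preserving X := by rw [trace_krausMap, hK, one_mul]
  completely_positive m X hX := by
    rw [ampliation_krausMap]
    exact posSemidef_sum _ fun i _ => hX.mul_mul_conjTranspose_same _

/-- The Kraus operators are read off from a square root of the Choi matrix of `T`, the image of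
the unnormalized maximally entangled state `ω`. -/
theorem IsQuantumOperation.exists_apply_single [DecidableEq n]
    {T : Matrix n n ℂ →ₗ[ℂ] Matrix n n ℂ} (hT : IsQuantumOperation T) :
    ∃ K : n × Fin (Fintype.card n) → Matrix n n ℂ,
      ∀ a b i j, T (Matrix.single a b 1) i j = ∑ s, K s i a * star (K s j b) := by
  let e := Fintype.equivFin n
  let ω : n × Fin (Fintype.card n) → ℂ := fun p => if e p.1 = p.2 then 1 else 0
  obtain ⟨L, hL⟩ := exists_eq_conjTranspose_mul_self
    (hT.completely_positive _ _ (posSemidef_vecMulVec_self_star ω))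
  refine ⟨fun s => Matrix.of fun i a => star (L s (i, e a)), fun a b i j => ?_⟩
  have hω : (Matrix.of fun i j => vecMulVec ω (star ω) (i, e a) (j, e b)) =
      Matrix.single a b (1 : ℂ) := by
    ext i j
    simp [ω, vecMulVec_apply, Matrix.single_apply, eq_comm, ← ite_and, and_comm]
  calc T (Matrix.single a b 1) i j
      = ampliation T (vecMulVec ω (star ω)) (i, e a) (j, e b) := by
        rw [ampliation, Matrix.of_apply, hω]
    _ = _ := by simp [hL, Matrix.mul_apply]

theorem IsQuantumOperation.exists_kraus [DecidableEq n]
    {T : Matrix n n ℂ →ₗ[ℂ] Matrix n n ℂ} (hT : IsQuantumOperation T) :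
    ∃ K : n × Fin (Fintype.card n) → Matrix n n ℂ,
      IsKrausFamily K ∧ T = krausMap K := by
  obtain ⟨K, hK⟩ := hT.exists_apply_single
  have hTK : T = krausMap K := by
    refine Matrix.ext_linearMap _ fun a b => LinearMap.ext_ring (Matrix.ext fun i j => ?_)
    change T (Matrix.single a b 1) i j = krausMap K (Matrix.single a b 1) i j
    rw [hK, krausMap_apply, Matrix.sum_apply]
    refine Finset.sum_congr rfl fun s _ => ?_
    simp [Matrix.mul_apply, Matrix.single_apply, ite_and]
  refine ⟨K, Matrix.ext_iff_trace_mul_right.2 fun X => ?_, hTK⟩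
  rw [← trace_krausMap, ← hTK, hT.trace_preserving, one_mul]

theorem isKrausFamily_partialIsometry [DecidableEq n] {W : Matrix n n ℂ} (hW : W * Wᴴ * W = W) :
    IsKrausFamily ![W, 1 - Wᴴ * W] := by
  have hproj : Wᴴ * W * (Wᴴ * W) = Wᴴ * W := by
    rw [Matrix.mul_assoc, ← Matrix.mul_assoc W, hW]
  simp only [IsKrausFamily, Fin.sum_univ_two, cons_val_zero, cons_val_one,
    conjTranspose_sub, conjTranspose_one, conjTranspose_mul, conjTranspose_conjTranspose]
  rw [Matrix.mul_sub, Matrix.sub_mul, Matrix.sub_mul, hproj]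
  simp

theorem IsKrausFamily.posSemidef_sum_mul_conjTranspose_sub {l m : Type*} [Finite l]
    [Fintype ι] [Fintype m] [DecidableEq n] {S : ι → Matrix m n ℂ} (hS : IsKrausFamily S)
    (C : ι → Matrix l m ℂ) :
    (∑ j, C j * (C j)ᴴ - (∑ j, C j * S j) * (∑ j, C j * S j)ᴴ).PosSemidef := by
  set X := ∑ j, C j * S j with hX
  have hsq : ∑ j, (C j - X * (S j)ᴴ) * (C j - X * (S j)ᴴ)ᴴ = ∑ j, C j * (C j)ᴴ - X * Xᴴ :=
    calc ∑ j, (C j - X * (S j)ᴴ) * (C j - X * (S j)ᴴ)ᴴ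
        = ∑ j, C j * (C j)ᴴ - (∑ j, C j * S j) * Xᴴ - X * (∑ j, C j * S j)ᴴ
            + X * (∑ j, (S j)ᴴ * S j) * Xᴴ := by
          simp only [conjTranspose_sub, conjTranspose_mul, conjTranspose_conjTranspose,
            Matrix.sub_mul, Matrix.mul_sub, Finset.sum_sub_distrib, Matrix.sum_mul,
            Matrix.mul_sum, conjTranspose_sum, Matrix.mul_assoc]
          abel
      _ = ∑ j, C j * (C j)ᴴ - X * Xᴴ := by
          rw [← hX, hS, Matrix.mul_one]
          abel
  rw [← hsq]
  exact posSemidef_sum _ fun j _ => posSemidef_self_mul_conjTranspose _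

omit [Fintype n] in
theorem IsKrausFamily.blocks {κ m m' n' : Type*} [Fintype ι] [Fintype κ] [Fintype m] [Fintype m']
    [DecidableEq n] [DecidableEq n'] {K : ι → Matrix m' n' ℂ} (hK : IsKrausFamily K)
    (e : m × κ ≃ m') {f : n → n'} (hf : f.Injective) :
    IsKrausFamily fun p : ι × κ => (K p.1).submatrix (fun x => e (x, p.2)) f := by
  ext a b
  have h := congrFun (congrFun hK (f a)) (f b)
  simp only [Matrix.sum_apply, Matrix.mul_apply, conjTranspose_apply, submatrix_apply,
    Fintype.sum_prod_type_right, ← e.sum_comp, Matrix.one_apply, hf.eq_iff] at h ⊢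
  rw [← h, Finset.sum_comm]

end Kraus

/-! ### Winning probabilities in terms of Kraus operators -/

section applyOn

variable {Y n R ι : Type*} [Fintype ι] (e : Y ≃ n × R)

theorem applyOn_sum (T : Matrix n n ℂ →ₗ[ℂ] Matrix n n ℂ) (ρ : ι → Matrix Y Y ℂ) :
    applyOn e T (∑ i, ρ i) = ∑ i, applyOn e T (ρ i) := by
  have hblock : ∀ r s, (of fun i j => ∑ k, ρ k (e.symm (i, r)) (e.symm (j, s))) =
      ∑ k, of fun i j => ρ k (e.symm (i, r)) (e.symm (j, s)) := by
    intro r s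
    ext i j
    simp [Matrix.sum_apply]
  ext y z
  simp only [applyOn, ampliation, reindex_apply, submatrix_apply, of_apply, Equiv.symm_symm,
    Matrix.sum_apply, hblock, map_sum]

variable [Fintype n]

/-- The operator `K ⊗ 1` applied to a vector on registers `Y` that split as `n` and a rest `R`. -/
def actOn (K : Matrix n n ℂ) (u : Y → ℂ) : Y → ℂ :=
  fun y => ∑ x, K (e y).1 x * u (e.symm (x, (e y).2))

theorem applyOn_krausMap_vecMulVec (K : ι → Matrix n n ℂ) (u : Y → ℂ) :
    applyOn e (krausMap K) (vecMulVec u (star u)) =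
      ∑ i, vecMulVec (actOn e (K i) u) (star (actOn e (K i) u)) := by
  ext y z
  simp only [applyOn, ampliation, krausMap_apply, reindex_apply, submatrix_apply, of_apply,
    Matrix.sum_apply, Equiv.symm_symm, Matrix.mul_apply, vecMulVec_apply, actOn, Pi.star_apply,
    star_sum, star_mul', Finset.sum_mul, Finset.mul_sum, conjTranspose_apply]
  exact Finset.sum_congr rfl fun i _ => Finset.sum_congr rfl fun a _ =>
    Finset.sum_congr rfl fun b _ => by ring

end applyOn

namespace RankOneGame

variable {A B C ι κ : Type*} [Fintype A] [Fintype B] [Fintype C] [Fintype ι] [Fintype κ]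
  (G : RankOneGame A B C) {d : ℕ}

/-- The vector `|ψ⟩ ⊗ |0⟩`. -/
def initialVector (d : ℕ) : (A × B × C) × Fin (d + 1) → ℂ :=
  fun y => if y.2 = 0 then G.ψ y.1 else 0

theorem initialState_eq (d : ℕ) :
    G.initialState d = vecMulVec (G.initialVector d) (star (G.initialVector d)) := by
  ext ⟨y, e⟩ ⟨z, f⟩
  by_cases he : e = 0 <;> by_cases hf : f = 0 <;>
    simp [initialState, initialVector, ketBra, vecMulVec_apply, he, hf]

theorem winProb_sum (ρ : ι → Matrix ((A × B × C) × Fin (d + 1)) ((A × B × C) × Fin (d + 1)) ℂ) :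
    G.winProb (∑ i, ρ i) = ∑ i, G.winProb (ρ i) := by
  simp only [winProb, Matrix.mul_sum, trace_sum, Complex.re_sum]

theorem winProb_vecMulVec (u : (A × B × C) × Fin (d + 1) → ℂ) :
    G.winProb (vecMulVec u (star u)) = ∑ e, ‖∑ y, star (G.γ y) * u (y, e)‖ ^ 2 := by
  have hmul : ∀ y e, ((ketBra G.γ G.γ ⊗ₖ (1 : Matrix (Fin (d + 1)) (Fin (d + 1)) ℂ)) *ᵥ u)
      (y, e) = G.γ y * ∑ z, star (G.γ z) * u (z, e) := by
    intro y e
    simp [mulVec, dotProduct, Fintype.sum_prod_type, ketBra, vecMulVec_apply, Matrix.one_apply,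
      Finset.mul_sum, mul_assoc]
  rw [winProb, mul_vecMulVec, trace_vecMulVec, dotProduct, Fintype.sum_prod_type_right,
    Complex.re_sum]
  refine Finset.sum_congr rfl fun e _ => ?_
  rw [← Complex.ofReal_re (‖_‖ ^ 2), Complex.ofReal_pow, ← Complex.mul_conj', map_sum,
    Finset.mul_sum]
  congr 1
  refine Finset.sum_congr rfl fun y _ => ?_
  simp only [hmul, Pi.star_apply, map_mul, ← starRingEnd_apply, Complex.conj_conj]
  ring

theorem trace_gameMatrix_mul (K : Matrix (A × B) (A × B) ℂ) :
    (G.gameMatrix * K).trace =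
      ∑ y, star (G.γ y) * ∑ x : A × B, K (y.1, y.2.1) x * G.ψ (x.1, x.2, y.2.2) := by
  rw [trace_mul_comm]
  simp only [Matrix.trace, diag, Matrix.mul_apply, gameMatrix, ketBra, of_apply, vecMulVec_apply,
    Finset.mul_sum]
  rw [Fintype.sum_prod_type, Fintype.sum_prod_type]
  refine Finset.sum_congr rfl fun a _ => ?_
  rw [Fintype.sum_prod_type]
  refine Finset.sum_congr rfl fun b _ => ?_
  rw [Finset.sum_comm]
  exact Finset.sum_congr rfl fun c _ => Finset.sum_congr rfl fun x _ => by ring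

theorem sum_mul_initialVector (g : Fin (d + 1) → ℂ) (y : A × B × C) :
    ∑ f, g f * G.initialVector d (y, f) = g 0 * G.ψ y := by
  simp [initialVector]

/-- The block `⟨e| K |0⟩` of an operator `K` on the registers `A`, `B` and the auxiliary one. -/
def jointBlock (K : Matrix (A × B × Fin (d + 1)) (A × B × Fin (d + 1)) ℂ) (e : Fin (d + 1)) :
    Matrix (A × B) (A × B) ℂ :=
  K.submatrix (fun x => (x.1, x.2, e)) fun x => (x.1, x.2, 0)

/-- The block `⟨e| K |f⟩` of an operator `K` on a register and the auxiliary one. -/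
def auxBlock {n : Type*} (K : Matrix (n × Fin (d + 1)) (n × Fin (d + 1)) ℂ) (e f : Fin (d + 1)) :
    Matrix n n ℂ :=
  K.submatrix (fun x => (x, e)) fun x => (x, f)

theorem winProb_krausMap (K : ι → Matrix (A × B × Fin (d + 1)) (A × B × Fin (d + 1)) ℂ) :
    G.winProb (applyOn (registersABE A B C (Fin (d + 1))) (krausMap K) (G.initialState d)) =
      ∑ i, ∑ e, ‖(G.gameMatrix * jointBlock (K i) e).trace‖ ^ 2 := by
  have hact : ∀ i e y, actOn (registersABE A B C (Fin (d + 1))) (K i) (G.initialVector d) (y, e) =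
      ∑ x : A × B, jointBlock (K i) e (y.1, y.2.1) x * G.ψ (x.1, x.2, y.2.2) := by
    intro i e y
    simp [actOn, registersABE, sum_mul_initialVector, jointBlock, Fintype.sum_prod_type]
  simp only [initialState_eq, applyOn_krausMap_vecMulVec, winProb_sum, winProb_vecMulVec,
    trace_gameMatrix_mul, hact]

theorem winProb_krausMap_krausMap (T : ι → Matrix (A × Fin (d + 1)) (A × Fin (d + 1)) ℂ)
    (S : κ → Matrix (B × Fin (d + 1)) (B × Fin (d + 1)) ℂ) :
    G.winProb (applyOn (registersBE A B C (Fin (d + 1))) (krausMap S)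
        (applyOn (registersAE A B C (Fin (d + 1))) (krausMap T) (G.initialState d))) =
      ∑ i, ∑ j, ∑ e, ‖∑ f, (G.gameMatrix *
        (auxBlock (T i) f 0 ⊗ₖ auxBlock (S j) e f)).trace‖ ^ 2 := by
  have hact : ∀ i j e y, actOn (registersBE A B C (Fin (d + 1))) (S j)
      (actOn (registersAE A B C (Fin (d + 1))) (T i) (G.initialVector d)) (y, e) =
      ∑ f, ∑ x : A × B, (auxBlock (T i) f 0 ⊗ₖ auxBlock (S j) e f) (y.1, y.2.1) x *
        G.ψ (x.1, x.2, y.2.2) := by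
    intro i j e y
    simp only [actOn, registersBE, registersAE, auxBlock, Fintype.sum_prod_type,
      Equiv.coe_fn_mk, Equiv.coe_fn_symm_mk, sum_mul_initialVector,
      kroneckerMap_apply, submatrix_apply, Finset.mul_sum]
    rw [Finset.sum_comm]
    refine Finset.sum_congr rfl fun f _ => ?_
    rw [Finset.sum_comm]
    exact Finset.sum_congr rfl fun a _ => Finset.sum_congr rfl fun b _ => by ring
  simp only [initialState_eq, applyOn_krausMap_vecMulVec, applyOn_sum, winProb_sum,
    winProb_vecMulVec, trace_gameMatrix_mul, hact]
  simp only [Finset.mul_sum, Finset.sum_comm (γ := Fin (d + 1)) (α := A × B × C)]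

theorem isKrausFamily_jointBlock [DecidableEq A] [DecidableEq B]
    {K : ι → Matrix (A × B × Fin (d + 1)) (A × B × Fin (d + 1)) ℂ} (hK : IsKrausFamily K) :
    IsKrausFamily fun p : ι × Fin (d + 1) => jointBlock (K p.1) p.2 := by
  have hinj : Function.Injective fun x : A × B => (x.1, x.2, (0 : Fin (d + 1))) := fun x y h => by
    simpa [Prod.ext_iff] using h
  exact hK.blocks (Equiv.prodAssoc A B (Fin (d + 1))) hinj

theorem isKrausFamily_auxBlock {n : Type*} [Fintype n] [DecidableEq n]
    {K : ι → Matrix (n × Fin (d + 1)) (n × Fin (d + 1)) ℂ} (hK : IsKrausFamily K)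
    (f : Fin (d + 1)) :
    IsKrausFamily fun p : ι × Fin (d + 1) => auxBlock (K p.1) p.2 f :=
  hK.blocks (Equiv.refl _) (f := fun x => (x, f)) fun _ _ h => congrArg Prod.fst h

theorem gameMatrix_parallel (k : ℕ) :
    (G.parallel k).gameMatrix = bipartitePow G.gameMatrix k := by
  classical
  ext ⟨f, g⟩ ⟨f', g'⟩
  simp only [gameMatrix, parallel, bipartitePow_apply, of_apply, ketBra, vecMulVec_apply,
    tensorPower, star_prod, Finset.prod_mul_distrib, Fintype.prod_sum]

end RankOneGame

/-! ### The trace norm -/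

theorem exists_linearIsometry_apply_eq {𝕜 E F : Type*} [RCLike 𝕜] [AddCommGroup E] [Module 𝕜 E]
    [NormedAddCommGroup F] [InnerProductSpace 𝕜 F] [FiniteDimensional 𝕜 F] {f g : E →ₗ[𝕜] F}
    (h : ∀ x, ‖g x‖ = ‖f x‖) : ∃ W : F →ₗᵢ[𝕜] F, ∀ x, W (f x) = g x := by
  obtain ⟨s, hs⟩ := f.rangeRestrict.exists_rightInverse_of_surjective f.range_rangeRestrict
  have hfs : ∀ y, f (s y) = y := fun y => congrArg Subtype.val (LinearMap.congr_fun hs y)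
  let L : f.range →ₗᵢ[𝕜] F := ⟨g ∘ₗ s, fun y => by simp [h, hfs]⟩
  refine ⟨L.extend, fun x => ?_⟩
  have hzero : ‖g (s ⟨f x, x, rfl⟩ - x)‖ = 0 := by rw [h, map_sub, hfs, sub_self, norm_zero]
  rw [norm_eq_zero, map_sub, sub_eq_zero] at hzero
  exact (L.extend_apply ⟨f x, x, rfl⟩).trans hzero

section traceNorm

variable {n ι : Type*} [Fintype n] [DecidableEq n] [Fintype ι]

theorem exists_unitary_mul_eq {M N : Matrix n n ℂ} (h : Mᴴ * M = Nᴴ * N) :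
    ∃ U ∈ unitaryGroup n ℂ, U * N = M := by
  have hnorm_sq : ∀ (X : Matrix n n ℂ) (x : EuclideanSpace ℂ n),
      ‖toEuclideanLin X x‖ ^ 2 = RCLike.re (star x.ofLp ⬝ᵥ (Xᴴ * X) *ᵥ x.ofLp) := by
    intro X x
    rw [← inner_self_eq_norm_sq (𝕜 := ℂ), EuclideanSpace.inner_eq_star_dotProduct,
      ofLp_toLpLin, toLin'_apply, ← mulVec_mulVec, dotProduct_mulVec, ← star_mulVec,
      dotProduct_comm]
  obtain ⟨W, hW⟩ := exists_linearIsometry_apply_eq (f := toEuclideanLin N) (g := toEuclideanLin M)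
    fun x => (sq_eq_sq₀ (norm_nonneg _) (norm_nonneg _)).1 (by rw [hnorm_sq, hnorm_sq, h])
  obtain ⟨U, hU⟩ := toEuclideanLin.surjective W.toLinearMap
  refine ⟨U, mem_unitaryGroup_iff'.2 (toEuclideanLin.injective ?_), toEuclideanLin.injective ?_⟩
  · rw [toLpLin_mul_same, star_eq_conjTranspose, toEuclideanLin_conjTranspose_eq_adjoint, hU,
      W.adjoint_comp_self', toLpLin_one]
  · rw [toLpLin_mul_same, hU]
    exact LinearMap.ext hW

theorem traceNorm_eq_trace {M S : Matrix n n ℂ} (hS : S.PosSemidef) (h : S * S = Mᴴ * M) :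
    (traceNorm M : ℂ) = S.trace := by
  open scoped MatrixOrder in
  have hM := posSemidef_conjTranspose_mul_self M
  rw [← CFC.sqrt_unique h hS.nonneg, CFC.sqrt_eq_cfc, cfc_nnreal_eq_real _ (Mᴴ * M),
    hM.1.cfc_eq, IsHermitian.cfc, Unitary.conjStarAlgAut_apply, Matrix.trace_mul_cycle,
    Unitary.coe_star_mul_self, Matrix.one_mul, trace_diagonal]
  simp [traceNorm, hM.eigenvalues_nonneg]

theorem exists_polar_decomposition (M : Matrix n n ℂ) :
    ∃ U ∈ unitaryGroup n ℂ, ∃ S : Matrix n n ℂ,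
      S.PosSemidef ∧ U * S = M ∧ S.trace = traceNorm M := by
  open scoped MatrixOrder in
  have hM := posSemidef_conjTranspose_mul_self M
  have hS : (CFC.sqrt (Mᴴ * M)).PosSemidef := nonneg_iff_posSemidef.1 (CFC.sqrt_nonneg _)
  have hSS : CFC.sqrt (Mᴴ * M) * CFC.sqrt (Mᴴ * M) = Mᴴ * M := CFC.sqrt_mul_sqrt_self _ hM.nonneg
  obtain ⟨U, hU, hUS⟩ := exists_unitary_mul_eq (by rw [hS.1.eq, hSS] :
    Mᴴ * M = (CFC.sqrt (Mᴴ * M))ᴴ * CFC.sqrt (Mᴴ * M))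
  exact ⟨U, hU, _, hS, hUS, (traceNorm_eq_trace hS hSS).symm⟩

theorem traceNorm_bipartitePow {A B : Type*} [Fintype A] [Fintype B] [DecidableEq A]
    [DecidableEq B] (M : Matrix (A × B) (A × B) ℂ) (k : ℕ) :
    traceNorm (bipartitePow M k) = traceNorm M ^ k := by
  obtain ⟨U, hU, S, hS, rfl, htr⟩ := exists_polar_decomposition M
  have hmul : bipartitePow S k * bipartitePow S k =
      (bipartitePow (U * S) k)ᴴ * bipartitePow (U * S) k := by
    simp only [bipartitePow, conjTranspose_submatrix, submatrix_mul_equiv,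
      conjTranspose_piKronecker, piKronecker_mul, conjTranspose_mul, hS.1.eq]
    rw [Matrix.mul_assoc S, ← Matrix.mul_assoc Uᴴ, ← star_eq_conjTranspose,
      mem_unitaryGroup_iff'.1 hU, Matrix.one_mul]
  have htrace : (bipartitePow S k).trace = S.trace ^ k := by
    simpa [piKronecker_one] using
      trace_bipartitePow_mul_kronecker S (fun _ : Fin k => 1) fun _ => 1
  have hval := traceNorm_eq_trace (S := bipartitePow S k)
    ((posSemidef_piKronecker fun _ => hS).submatrix _) hmul
  rw [htrace, htr] at hval
  exact_mod_cast hval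

theorem sum_norm_sq_le_sq_of_forall {z : ι → ℂ} {t : ℝ}
    (h : ∀ c : ι → ℂ, 2 * (∑ i, c i * z i).re ≤ t * (1 + ∑ i, ‖c i‖ ^ 2)) :
    ∑ i, ‖z i‖ ^ 2 ≤ t ^ 2 := by
  have hdiscrim : discrim (t * ∑ i, ‖z i‖ ^ 2) (-(2 * ∑ i, ‖z i‖ ^ 2)) t ≤ 0 := by
    refine discrim_le_zero fun s => ?_
    have hs := h fun i => s * star (z i)
    have hre : (∑ i, s * star (z i) * z i).re = s * ∑ i, ‖z i‖ ^ 2 := by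
      rw [← Complex.ofReal_re (s * _)]
      simp [Finset.mul_sum, mul_assoc, Complex.conj_mul']
    simp only [hre, norm_mul, norm_star, mul_pow, ← Finset.mul_sum, Complex.norm_real,
      Real.norm_eq_abs, sq_abs] at hs
    linarith
  have hnonneg : 0 ≤ ∑ i, ‖z i‖ ^ 2 := by positivity
  rw [discrim] at hdiscrim
  nlinarith

theorem IsKrausFamily.sum_norm_trace_mul_sq_le {K : ι → Matrix n n ℂ} (hK : IsKrausFamily K)
    (M : Matrix n n ℂ) : ∑ i, ‖(M * K i).trace‖ ^ 2 ≤ traceNorm M ^ 2 := by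
  obtain ⟨U, hU, S, hS, rfl, htr⟩ := exists_polar_decomposition M
  refine sum_norm_sq_le_sq_of_forall fun c => ?_
  have hterm : ∀ i, (S * ((K i * U - star (c i) • (1 : Matrix n n ℂ))ᴴ *
      (K i * U - star (c i) • (1 : Matrix n n ℂ)))).trace =
      (S * (Uᴴ * ((K i)ᴴ * K i) * U)).trace + (‖c i‖ ^ 2 : ℝ) * S.trace -
        (c i * (U * S * K i).trace + star (c i * (U * S * K i).trace)) := by
    intro i
    rw [star_mul', ← trace_conjTranspose (U * S * K i)]
    simp only [conjTranspose_sub, conjTranspose_smul, conjTranspose_mul, conjTranspose_one,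
      star_star, hS.1.eq, Matrix.sub_mul, Matrix.mul_sub, trace_sub, Matrix.smul_mul,
      Matrix.mul_smul, trace_smul, Matrix.one_mul, Matrix.mul_one, smul_eq_mul,
      Complex.ofReal_pow, ← Complex.mul_conj']
    rw [Matrix.mul_assoc U, Matrix.trace_mul_comm U, Matrix.trace_mul_comm (K i)ᴴ]
    simp only [Matrix.mul_assoc, starRingEnd_apply]
    ring
  have hsum : ∑ i, (S * (Uᴴ * ((K i)ᴴ * K i) * U)).trace = S.trace := by
    rw [← trace_sum, ← Matrix.mul_sum, ← Matrix.sum_mul, ← Matrix.mul_sum, hK, Matrix.mul_one,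
      ← star_eq_conjTranspose, mem_unitaryGroup_iff'.1 hU, Matrix.mul_one]
  have hnonneg := Finset.sum_nonneg fun i (_ : i ∈ Finset.univ) =>
    trace_mul_nonneg_of_posSemidef hS (posSemidef_conjTranspose_mul_self
      (K i * U - star (c i) • (1 : Matrix n n ℂ)))
  simp only [hterm, Finset.sum_sub_distrib, Finset.sum_add_distrib, hsum, htr] at hnonneg
  have hre := (Complex.le_def.1 hnonneg).1
  simp only [Complex.zero_re, Complex.sub_re, Complex.add_re, ← Finset.sum_mul,
    ← Complex.ofReal_sum, Complex.re_mul_ofReal, Complex.ofReal_re, Complex.star_def,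
    Complex.re_sum, Complex.conj_re] at hre
  rw [Complex.re_sum]
  linarith

end traceNorm

namespace RankOneGame

variable {A B C : Type*} [Fintype A] [Fintype B] [Fintype C] (G : RankOneGame A B C)

theorem winProb_le_traceNorm_sq [DecidableEq A] [DecidableEq B] {d : ℕ}
    {W : Matrix (A × B × Fin (d + 1)) (A × B × Fin (d + 1)) ℂ →ₗ[ℂ]
      Matrix (A × B × Fin (d + 1)) (A × B × Fin (d + 1)) ℂ} (hW : IsQuantumOperation W) :
    G.winProb (applyOn (registersABE A B C (Fin (d + 1))) W (G.initialState d)) ≤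
      traceNorm G.gameMatrix ^ 2 := by
  obtain ⟨K, hK, rfl⟩ := hW.exists_kraus
  rw [winProb_krausMap, ← Fintype.sum_prod_type']
  exact (isKrausFamily_jointBlock hK).sum_norm_trace_mul_sq_le _

theorem exists_winProb_eq_traceNorm_sq [DecidableEq A] [DecidableEq B] :
    ∃ W : Matrix (A × B × Fin 1) (A × B × Fin 1) ℂ →ₗ[ℂ] Matrix (A × B × Fin 1) (A × B × Fin 1) ℂ,
      IsQuantumOperation W ∧
        G.winProb (applyOn (registersABE A B C (Fin 1)) W (G.initialState 0)) =
          traceNorm G.gameMatrix ^ 2 := by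
  obtain ⟨U, hU, S, -, hUS, htr⟩ := exists_polar_decomposition G.gameMatrix
  have hUU := mem_unitaryGroup_iff.1 hU
  let e : A × B × Fin 1 ≃ A × B := (Equiv.prodAssoc A B (Fin 1)).symm.trans (Equiv.prodUnique _ _)
  have hblock : ∀ f, jointBlock (Uᴴ.submatrix e e) f = Uᴴ := fun f => rfl
  refine ⟨krausMap fun _ : Unit => Uᴴ.submatrix e e,
    IsKrausFamily.isQuantumOperation_krausMap ?_, ?_⟩
  · rw [star_eq_conjTranspose] at hUU
    simp [IsKrausFamily, hUU]
  · have hval : (G.gameMatrix * Uᴴ).trace = traceNorm G.gameMatrix := by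
      rw [← hUS, trace_mul_cycle, ← star_eq_conjTranspose, mem_unitaryGroup_iff'.1 hU,
        Matrix.one_mul, htr, hUS]
    rw [winProb_krausMap]
    simp only [hblock, hval]
    simp

theorem maximalValue_eq_traceNorm_sq [DecidableEq A] [DecidableEq B] :
    G.maximalValue = traceNorm G.gameMatrix ^ 2 := by
  obtain ⟨W, hW, hval⟩ := G.exists_winProb_eq_traceNorm_sq
  refine IsGreatest.csSup_eq ⟨⟨0, W, hW, hval.symm⟩, ?_⟩
  rintro p ⟨d, W, hW, rfl⟩
  exact G.winProb_le_traceNorm_sq hW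

theorem maximalValue_parallel (k : ℕ) : (G.parallel k).maximalValue = G.maximalValue ^ k := by
  classical
  rw [maximalValue_eq_traceNorm_sq, maximalValue_eq_traceNorm_sq, gameMatrix_parallel,
    traceNorm_bipartitePow, pow_right_comm]

end RankOneGame

/-! ### The Haagerup norm -/

theorem exists_isKrausFamily_sumElim_single {ι κ n : Type*} [Fintype ι] [Fintype κ] [Fintype n]
    [DecidableEq κ] [DecidableEq n] {K : ι → Matrix n n ℂ}
    (h : (1 - ∑ i, (K i)ᴴ * K i).PosSemidef) :
    ∃ L : Matrix n n ℂ, ∀ j : κ, IsKrausFamily (Sum.elim K (Pi.single j L)) := by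
  obtain ⟨L, hL⟩ := exists_eq_conjTranspose_mul_self h
  refine ⟨L, fun j => ?_⟩
  have hsum : ∑ x, ((Pi.single j L : κ → Matrix n n ℂ) x)ᴴ *
      (Pi.single j L : κ → Matrix n n ℂ) x = Lᴴ * L := by
    rw [Fintype.sum_eq_single j fun x hx => by simp [hx], Pi.single_eq_same]
  rw [IsKrausFamily, Fintype.sum_sum_type]
  simp only [Sum.elim_inl, Sum.elim_inr, hsum, ← hL, add_sub_cancel]

section haagerupNorm

variable {A B ι : Type*} [Fintype A] [Fintype B] [Fintype ι]

section amplitudes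

variable [DecidableEq A] [DecidableEq B]

/-- The moduli `|∑ₑ tr (M (Vₑ ⊗ Rₑ))|` for a column `(Vₑ)` with `∑ Vₑᴴ Vₑ = 1` and a row `(Rₑ)`
with `∑ Rₑ Rₑᴴ = 1`. -/
def amplitudes (M : Matrix (A × B) (A × B) ℂ) : Set ℝ :=
  {p | ∃ (d : ℕ) (V : Fin (d + 1) → Matrix A A ℂ) (R : Fin (d + 1) → Matrix B B ℂ),
    IsKrausFamily V ∧ IsKrausFamily (fun e => (R e)ᴴ) ∧ p = ‖∑ e, (M * (V e ⊗ₖ R e)).trace‖}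

theorem mem_amplitudes [Nonempty ι] (M : Matrix (A × B) (A × B) ℂ) {V : ι → Matrix A A ℂ}
    {R : ι → Matrix B B ℂ} (hV : IsKrausFamily V) (hR : IsKrausFamily fun e => (R e)ᴴ) :
    ‖∑ e, (M * (V e ⊗ₖ R e)).trace‖ ∈ amplitudes M := by
  obtain ⟨d, hd⟩ := Nat.exists_eq_succ_of_ne_zero (Fintype.card_ne_zero (α := ι))
  let σ := (Fintype.equivFinOfCardEq hd).symm
  refine ⟨_, V ∘ σ, R ∘ σ, ?_, ?_, congrArg _ (σ.sum_comp _).symm⟩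
  · exact (σ.sum_comp fun e => (V e)ᴴ * V e).trans hV
  · exact (σ.sum_comp fun e => (R e)ᴴᴴ * (R e)ᴴ).trans hR

theorem nonempty_amplitudes (M : Matrix (A × B) (A × B) ℂ) : (amplitudes M).Nonempty :=
  ⟨_, mem_amplitudes (ι := Unit) (V := fun _ => 1) (R := fun _ => 1) M
    (by simp [IsKrausFamily]) (by simp [IsKrausFamily])⟩

/-- The norm of the functional `X ↦ tr (M X)` on the Haagerup tensor product of the matrix algebras
on `ℂ^A` and `ℂ^B`. -/
def haagerupNorm (M : Matrix (A × B) (A × B) ℂ) : ℝ :=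
  sSup (amplitudes M)

theorem haagerupNorm_nonneg (M : Matrix (A × B) (A × B) ℂ) : 0 ≤ haagerupNorm M := by
  refine Real.sSup_nonneg ?_
  rintro _ ⟨d, V, R, -, -, rfl⟩
  exact norm_nonneg _

end amplitudes

section haagerupDual

/-- The matrix with `⟨vec Vᴴ, realign M (vec R)⟩ = tr (M (V ⊗ R))`. -/
def realign (M : Matrix (A × B) (A × B) ℂ) : Matrix (A × A) (B × B) ℂ :=
  Matrix.of fun a b => M (a.2, b.1) (a.1, b.2)

theorem star_vec_dotProduct_realign_mulVec (M : Matrix (A × B) (A × B) ℂ) (V : Matrix A A ℂ)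
    (R : Matrix B B ℂ) : star (vec Vᴴ) ⬝ᵥ (realign M *ᵥ vec R) = (M * (V ⊗ₖ R)).trace := by
  simp only [dotProduct, mulVec, Matrix.trace, diag, Matrix.mul_apply, realign, of_apply, vec,
    Pi.star_apply, conjTranspose_apply, star_star, kroneckerMap_apply, Finset.mul_sum,
    Fintype.sum_prod_type]
  rw [Finset.sum_comm]
  refine Finset.sum_congr rfl fun a _ => ?_
  rw [Finset.sum_comm]
  refine Finset.sum_congr rfl fun b _ => Finset.sum_congr rfl fun a' _ =>
    Finset.sum_congr rfl fun b' _ => ?_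
  ring

variable [DecidableEq A] [DecidableEq B]

/-- The slack matrix of the semidefinite program dual to the supremum defining `haagerupNorm M`:
when it is positive semidefinite, `(P, Q)` certifies the bound `(tr P + tr Q) / 2`. -/
def haagerupDual (M : Matrix (A × B) (A × B) ℂ) (P : Matrix A A ℂ) (Q : Matrix B B ℂ) :
    Matrix (A × A ⊕ B × B) (A × A ⊕ B × B) ℂ :=
  fromBlocks (1 ⊗ₖ P) (realign M) (realign M)ᴴ (1 ⊗ₖ Q)

variable (M : Matrix (A × B) (A × B) ℂ) (P : Matrix A A ℂ) (Q : Matrix B B ℂ)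

theorem star_dotProduct_haagerupDual_mulVec (V : Matrix A A ℂ) (R : Matrix B B ℂ) :
    star (Sum.elim (vec Vᴴ) (vec R)) ⬝ᵥ
        (haagerupDual M P Q *ᵥ Sum.elim (vec Vᴴ) (vec R)) =
      (P * (Vᴴ * V)).trace + (Q * (R * Rᴴ)).trace +
        ((M * (V ⊗ₖ R)).trace + star (M * (V ⊗ₖ R)).trace) := by
  have hadj : star (vec R) ⬝ᵥ ((realign M)ᴴ *ᵥ vec Vᴴ) = star (M * (V ⊗ₖ R)).trace := by
    rw [← star_vec_dotProduct_realign_mulVec, star_dotProduct, star_mulVec,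
      conjTranspose_conjTranspose, ← dotProduct_mulVec]
  rw [haagerupDual, fromBlocks_mulVec]
  simp only [Function.star_sumElim, sumElim_dotProduct_sumElim, dotProduct_add, hadj,
    Sum.elim_comp_inl, Sum.elim_comp_inr,
    star_vec_dotProduct_realign_mulVec, kronecker_mulVec_vec, star_vec_dotProduct_vec,
    transpose_one, Matrix.mul_one, conjTranspose_conjTranspose]
  rw [trace_mul_comm V, trace_mul_comm Rᴴ, Matrix.mul_assoc, Matrix.mul_assoc]
  ring

theorem sum_star_dotProduct_haagerupDual_mulVec_re (V : ι → Matrix A A ℂ)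
    (R : ι → Matrix B B ℂ) :
    (∑ i, star (Sum.elim (vec (V i)ᴴ) (vec (R i))) ⬝ᵥ
        (haagerupDual M P Q *ᵥ Sum.elim (vec (V i)ᴴ) (vec (R i)))).re =
      (P * ∑ i, (V i)ᴴ * V i).trace.re + (Q * ∑ i, R i * (R i)ᴴ).trace.re +
        2 * (∑ i, (M * (V i ⊗ₖ R i)).trace).re := by
  simp only [star_dotProduct_haagerupDual_mulVec, Finset.sum_add_distrib, Matrix.mul_sum,
    trace_sum, Complex.add_re, Complex.re_sum, RCLike.star_def, Complex.conj_re]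
  ring

variable {M P Q}

omit [Fintype A] [Fintype B] in
theorem isHermitian_haagerupDual (hP : P.IsHermitian) (hQ : Q.IsHermitian) :
    (haagerupDual M P Q).IsHermitian := by
  refine IsHermitian.fromBlocks ?_ rfl ?_ <;>
    simp only [IsHermitian, conjTranspose_kronecker, conjTranspose_one, hP.eq, hQ.eq]

variable (M)

omit [Fintype A] [Fintype B] in
theorem haagerupDual_convexCombination (P P' : Matrix A A ℂ) (Q Q' : Matrix B B ℂ) {a b : ℝ}
    (hab : a + b = 1) :
    haagerupDual M (a • P + b • P') (a • Q + b • Q') =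
      a • haagerupDual M P Q + b • haagerupDual M P' Q' := by
  simp only [haagerupDual, fromBlocks_smul, fromBlocks_add, kronecker_add, kronecker_smul,
    ← add_smul, hab, one_smul]

omit [Fintype A] [Fintype B] in
theorem continuous_haagerupDual :
    Continuous fun x : Matrix A A ℂ × Matrix B B ℂ => haagerupDual M x.1 x.2 := by
  refine Continuous.matrix_fromBlocks ?_ continuous_const continuous_const ?_ <;>
    exact continuous_matrix fun i j => by simp only [kroneckerMap_apply]; fun_prop

variable {M}

theorem two_mul_norm_sum_trace_le_of_posSemidef_haagerupDual
    (h : (haagerupDual M P Q).PosSemidef) {V : ι → Matrix A A ℂ} {R : ι → Matrix B B ℂ}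
    (hV : IsKrausFamily V) (hR : IsKrausFamily fun e => (R e)ᴴ) :
    2 * ‖∑ e, (M * (V e ⊗ₖ R e)).trace‖ ≤ P.trace.re + Q.trace.re := by
  obtain ⟨c, hc, hz⟩ : ∃ c : ℂ, ‖c‖ = 1 ∧ (‖∑ e, (M * (V e ⊗ₖ R e)).trace‖ : ℂ) =
      c * ∑ e, (M * (V e ⊗ₖ R e)).trace := RCLike.exists_norm_eq_mul_self _
  have hnonneg := (Complex.nonneg_iff.1 <| Finset.sum_nonneg fun e (_ : e ∈ Finset.univ) =>
    h.dotProduct_mulVec_nonneg (Sum.elim (vec (V e)ᴴ) (vec (-c • R e)))).1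
  have hphase : ∑ e, (-c • R e) * (-c • R e)ᴴ = 1 := by
    simpa [smul_smul, ← Finset.smul_sum, Complex.conj_mul', hc, IsKrausFamily] using hR
  have htrace : ∑ e, (M * (V e ⊗ₖ (-c • R e))).trace =
      -(‖∑ e, (M * (V e ⊗ₖ R e)).trace‖ : ℂ) := by
    rw [hz, Finset.mul_sum, ← Finset.sum_neg_distrib]
    exact Finset.sum_congr rfl fun e _ => by
      rw [kronecker_smul, mul_smul_comm, trace_smul, smul_eq_mul, neg_mul]
  rw [sum_star_dotProduct_haagerupDual_mulVec_re, hV, hphase, htrace] at hnonneg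
  simp only [Matrix.mul_one, Complex.neg_re, Complex.ofReal_re] at hnonneg
  linarith

theorem haagerupNorm_le_of_posSemidef_haagerupDual (h : (haagerupDual M P Q).PosSemidef) :
    haagerupNorm M ≤ (P.trace.re + Q.trace.re) / 2 := by
  refine csSup_le (nonempty_amplitudes M) ?_
  rintro _ ⟨d, V, R, hV, hR, rfl⟩
  linarith [two_mul_norm_sum_trace_le_of_posSemidef_haagerupDual h hV hR]

variable (M)

omit [Fintype A] [Fintype B] in
theorem exists_posSemidef_haagerupDual [Finite A] [Finite B] :
    ∃ P Q, (haagerupDual M P Q).PosSemidef := by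
  have := Fintype.ofFinite A
  have := Fintype.ofFinite B
  obtain _ | _ := isEmpty_or_nonempty (A × A ⊕ B × B)
  · exact ⟨0, 0, Subsingleton.elim 0 (haagerupDual M 0 0) ▸ .zero⟩
  have hH : (-fromBlocks 0 (realign M) (realign M)ᴴ 0).IsHermitian :=
    (IsHermitian.fromBlocks isHermitian_zero rfl isHermitian_zero).neg
  obtain ⟨ρ, -, hρ⟩ := exists_densityMatrix_trace_smul_one_sub_posSemidef hH
  generalize (_ * ρ).trace.re = c at hρ
  refine ⟨c • 1, c • 1, ?_⟩
  convert hρ using 1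
  rw [haagerupDual, kronecker_smul, kronecker_smul, one_kronecker_one, one_kronecker_one,
    ← fromBlocks_one, fromBlocks_smul, sub_neg_eq_add, fromBlocks_add]
  simp

theorem bddAbove_amplitudes : BddAbove (amplitudes M) := by
  obtain ⟨P, Q, h⟩ := exists_posSemidef_haagerupDual M
  refine ⟨(P.trace.re + Q.trace.re) / 2, ?_⟩
  rintro _ ⟨d, V, R, hV, hR, rfl⟩
  linarith [two_mul_norm_sum_trace_le_of_posSemidef_haagerupDual h hV hR]

theorem le_haagerupNorm [Nonempty ι] {V : ι → Matrix A A ℂ} {R : ι → Matrix B B ℂ}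
    (hV : IsKrausFamily V) (hR : IsKrausFamily fun e => (R e)ᴴ) :
    ‖∑ e, (M * (V e ⊗ₖ R e)).trace‖ ≤ haagerupNorm M :=
  le_csSup (bddAbove_amplitudes M) (mem_amplitudes M hV hR)

end haagerupDual

section contractions

variable [DecidableEq A] [DecidableEq B] (M : Matrix (A × B) (A × B) ℂ)
  {V : ι → Matrix A A ℂ} {R : ι → Matrix B B ℂ}

theorem norm_sum_trace_le_haagerupNorm_of_contraction
    (hV : (1 - ∑ e, (V e)ᴴ * V e).PosSemidef) (hR : (1 - ∑ e, R e * (R e)ᴴ).PosSemidef) :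
    ‖∑ e, (M * (V e ⊗ₖ R e)).trace‖ ≤ haagerupNorm M := by
  obtain ⟨K, hK⟩ := exists_isKrausFamily_sumElim_single (κ := Fin 2) hV
  obtain ⟨L, hL⟩ := exists_isKrausFamily_sumElim_single (κ := Fin 2) (K := fun e => (R e)ᴴ)
    (by simpa using hR)
  have hrow : (fun e => (Sum.elim R (Pi.single 1 Lᴴ : Fin 2 → Matrix B B ℂ) e)ᴴ) =
      Sum.elim (fun e => (R e)ᴴ) (Pi.single 1 L) := by
    ext (e | j) : 1
    · rfl
    · fin_cases j <;> simp
  have hle := le_haagerupNorm M (hK 0) (R := Sum.elim R (Pi.single 1 Lᴴ)) (hrow ▸ hL 1)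
  simpa [Fintype.sum_sum_type, Fin.sum_univ_two] using hle

theorem two_mul_norm_sum_trace_le_of_pos {a b : ℝ} (ha : 0 < a) (hb : 0 < b)
    (hV : (a • 1 - ∑ e, (V e)ᴴ * V e).PosSemidef)
    (hR : (b • 1 - ∑ e, R e * (R e)ᴴ).PosSemidef) :
    2 * ‖∑ e, (M * (V e ⊗ₖ R e)).trace‖ ≤ haagerupNorm M * (a + b) := by
  have hV' : (1 - ∑ e, ((√a)⁻¹ • V e)ᴴ * ((√a)⁻¹ • V e)).PosSemidef := by
    convert hV.smul (inv_nonneg.2 ha.le) using 1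
    simp [smul_sub, smul_smul, ← Finset.smul_sum, ← mul_inv, ha.le, ha.ne']
  have hR' : (1 - ∑ e, ((√b)⁻¹ • R e) * ((√b)⁻¹ • R e)ᴴ).PosSemidef := by
    convert hR.smul (inv_nonneg.2 hb.le) using 1
    simp [smul_sub, smul_smul, ← Finset.smul_sum, ← mul_inv, hb.le, hb.ne']
  have hle := norm_sum_trace_le_haagerupNorm_of_contraction M hV' hR'
  simp only [smul_kronecker, kronecker_smul, mul_smul_comm, trace_smul, ← Finset.smul_sum,
    norm_smul, norm_inv, Real.norm_eq_abs, abs_of_nonneg (Real.sqrt_nonneg _)] at hle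
  rw [inv_mul_le_iff₀ (Real.sqrt_pos.2 hb), inv_mul_le_iff₀ (Real.sqrt_pos.2 ha)] at hle
  calc 2 * ‖∑ e, (M * (V e ⊗ₖ R e)).trace‖
      ≤ haagerupNorm M * (2 * √a * √b) := by linarith
    _ ≤ haagerupNorm M * (√a ^ 2 + √b ^ 2) := by
      gcongr
      · exact haagerupNorm_nonneg M
      · exact two_mul_le_add_sq _ _
    _ = haagerupNorm M * (a + b) := by rw [Real.sq_sqrt ha.le, Real.sq_sqrt hb.le]

theorem two_mul_norm_sum_trace_le {a b : ℝ} (ha : 0 ≤ a) (hb : 0 ≤ b)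
    (hV : (a • 1 - ∑ e, (V e)ᴴ * V e).PosSemidef)
    (hR : (b • 1 - ∑ e, R e * (R e)ᴴ).PosSemidef) :
    2 * ‖∑ e, (M * (V e ⊗ₖ R e)).trace‖ ≤ haagerupNorm M * (a + b) := by
  have hcont : Continuous fun ε : ℝ => haagerupNorm M * ((a + ε) + (b + ε)) := by fun_prop
  have hlim := (hcont.tendsto' 0 (haagerupNorm M * (a + b)) (by simp)).mono_left
    (nhdsWithin_le_nhds (s := Set.Ioi 0))
  refine ge_of_tendsto hlim (Filter.eventually_of_mem self_mem_nhdsWithin fun ε hε => ?_)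
  have hε : 0 < ε := hε
  refine two_mul_norm_sum_trace_le_of_pos M (by positivity) (by positivity) ?_ ?_
  · rw [add_smul, add_sub_right_comm]
    exact hV.add (PosSemidef.one.smul hε.le)
  · rw [add_smul, add_sub_right_comm]
    exact hR.add (PosSemidef.one.smul hε.le)

end contractions
end haagerupNorm

section minimax

variable {E n : Type*} [Fintype n] [TopologicalSpace E] [AddCommGroup E] [Module ℝ E]
  [IsTopologicalAddGroup E] [ContinuousSMul ℝ E]

/-- By Sion's minimax theorem, `y` may be chosen independently of the density matrix `Γ`. -/
theorem exists_posSemidef_of_forall_densityMatrices [Nonempty n] {Y : Set E} (hconv : Convex ℝ Y)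
    (hcomp : IsCompact Y) (hne : Y.Nonempty) {H : E → Matrix n n ℂ} (hcont : Continuous H)
    (haff : ∀ x y (a b : ℝ), a + b = 1 → H (a • x + b • y) = a • H x + b • H y)
    (hherm : ∀ y ∈ Y, (H y).IsHermitian)
    (h : ∀ Γ ∈ densityMatrices n, ∃ y ∈ Y, 0 ≤ (H y * Γ).trace.re) :
    ∃ y ∈ Y, (H y).PosSemidef := by
  obtain ⟨Γ₀, hΓ₀, y₀, hy₀, hsaddle⟩ := Sion.exists_isSaddlePointOn
    (f := fun (Γ : Matrix n n ℂ) y => (H y * Γ).trace.re)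
    nonempty_densityMatrices convex_densityMatrices isCompact_densityMatrices
    (fun y _ => (show Continuous fun Γ => (H y * Γ).trace.re by
      fun_prop).lowerSemicontinuous.lowerSemicontinuousOn _)
    (fun y _ => ConvexOn.quasiconvexOn ⟨convex_densityMatrices, fun Γ _ Γ' _ a b _ _ _ => by
      simp [Matrix.mul_add]⟩)
    hconv hne hcomp
    (fun Γ _ => (show Continuous fun y => (H y * Γ).trace.re by
      fun_prop).upperSemicontinuous.upperSemicontinuousOn _)
    (fun Γ _ => ConcaveOn.quasiconcaveOn ⟨hconv, fun x _ y _ a b _ _ hab => by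
      simp [haff x y a b hab, Matrix.add_mul]⟩)
  obtain ⟨y, hy, hnonneg⟩ := h Γ₀ hΓ₀
  exact ⟨y₀, hy₀, posSemidef_of_forall_densityMatrices (hherm y₀ hy₀) fun Γ hΓ =>
    hnonneg.trans (hsaddle Γ hΓ y hy)⟩

end minimax

section strongDuality

variable {A B : Type*} [Fintype A] [Fintype B] [DecidableEq A] [DecidableEq B]
  (M : Matrix (A × B) (A × B) ℂ)

theorem exists_nonneg_trace_haagerupDual_mul [Nonempty A] [Nonempty B]
    {Γ : Matrix (A × A ⊕ B × B) (A × A ⊕ B × B) ℂ} (hΓ : Γ.PosSemidef) :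
    ∃ ρ ∈ densityMatrices A, ∃ σ ∈ densityMatrices B,
      0 ≤ (haagerupDual M (haagerupNorm M • ρ) (haagerupNorm M • σ) * Γ).trace.re := by
  obtain ⟨L, rfl⟩ := exists_eq_conjTranspose_mul_self hΓ
  let V := fun l => Matrix.of fun a a' => L l (Sum.inl (a, a'))
  let R := fun l => Matrix.of fun b b' => star (L l (Sum.inr (b', b)))
  have hrow : ∀ l, star (L l) = Sum.elim (vec (V l)ᴴ) (vec (R l)) := fun l => by
    ext (x | x) <;> rfl
  have hX : (∑ l, (V l)ᴴ * V l).PosSemidef :=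
    posSemidef_sum _ fun l _ => posSemidef_conjTranspose_mul_self _
  have hY : (∑ l, R l * (R l)ᴴ).PosSemidef :=
    posSemidef_sum _ fun l _ => posSemidef_self_mul_conjTranspose _
  obtain ⟨ρ, hρ, hXρ⟩ := exists_densityMatrix_trace_smul_one_sub_posSemidef hX.1
  obtain ⟨σ, hσ, hYσ⟩ := exists_densityMatrix_trace_smul_one_sub_posSemidef hY.1
  refine ⟨ρ, hρ, σ, hσ, ?_⟩
  have hbound := two_mul_norm_sum_trace_le M
    (Complex.nonneg_iff.1 (trace_mul_nonneg_of_posSemidef hX hρ.1)).1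
    (Complex.nonneg_iff.1 (trace_mul_nonneg_of_posSemidef hY hσ.1)).1 hXρ hYσ
  have hre := neg_le_of_abs_le (Complex.abs_re_le_norm (∑ l, (M * (V l ⊗ₖ R l)).trace))
  rw [trace_mul_conjTranspose_mul_self_eq_sum]
  simp only [hrow]
  rw [sum_star_dotProduct_haagerupDual_mulVec_re, smul_mul_assoc, smul_mul_assoc, trace_smul,
    trace_smul, Complex.smul_re, Complex.smul_re, smul_eq_mul, smul_eq_mul, trace_mul_comm ρ,
    trace_mul_comm σ]
  linarith

theorem exists_haagerupDual_posSemidef_trace_eq [Nonempty A] [Nonempty B] :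
    ∃ P Q, (haagerupDual M P Q).PosSemidef ∧ P.trace = haagerupNorm M ∧
      Q.trace = haagerupNorm M := by
  obtain ⟨⟨ρ, σ⟩, ⟨hρ, hσ⟩, hdual⟩ := exists_posSemidef_of_forall_densityMatrices
    (Y := densityMatrices A ×ˢ densityMatrices B)
    (H := fun x => haagerupDual M (haagerupNorm M • x.1) (haagerupNorm M • x.2))
    (convex_densityMatrices.prod convex_densityMatrices)
    (isCompact_densityMatrices.prod isCompact_densityMatrices)
    (nonempty_densityMatrices.prod nonempty_densityMatrices)
    ((continuous_haagerupDual M).comp (continuous_id.const_smul (haagerupNorm M)))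
    (fun x y a b hab => by
      rw [← haagerupDual_convexCombination M _ _ _ _ hab]
      simp only [Prod.fst_add, Prod.snd_add, Prod.smul_fst, Prod.smul_snd, smul_add,
        smul_comm (haagerupNorm M)])
    (fun x hx => isHermitian_haagerupDual (hx.1.1.1.smul (.all _)) (hx.2.1.1.smul (.all _)))
    (fun Γ hΓ => by
      obtain ⟨ρ, hρ, σ, hσ, h⟩ := exists_nonneg_trace_haagerupDual_mul M hΓ.1
      exact ⟨(ρ, σ), ⟨hρ, hσ⟩, h⟩)
  exact ⟨_, _, hdual, by simp [hρ.2], by simp [hσ.2]⟩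

end strongDuality

section bipartitePow

variable {A B : Type*} [Fintype A] [Fintype B] [DecidableEq A] [DecidableEq B]
  {M : Matrix (A × B) (A × B) ℂ}

theorem isKrausFamily_piKronecker {ι κ m n : Type*} [Fintype ι] [DecidableEq ι] [Fintype κ]
    [Fintype m] [DecidableEq n] {K : ι → κ → Matrix m n ℂ} (hK : ∀ i, IsKrausFamily (K i)) :
    IsKrausFamily fun s : ι → κ => piKronecker fun i => K i (s i) := by
  simp only [IsKrausFamily, conjTranspose_piKronecker, piKronecker_mul]
  rw [sum_piKronecker fun i e => (K i e)ᴴ * K i e, funext hK, piKronecker_one]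

theorem pow_mem_amplitudes {p : ℝ} (hp : p ∈ amplitudes M) (k : ℕ) :
    p ^ k ∈ amplitudes (bipartitePow M k) := by
  obtain ⟨d, V, R, hV, hR, rfl⟩ := hp
  have hrow : IsKrausFamily fun s : Fin k → Fin (d + 1) => (piKronecker fun i => R (s i))ᴴ := by
    simp only [conjTranspose_piKronecker]
    exact isKrausFamily_piKronecker (K := fun _ e => (R e)ᴴ) fun _ => hR
  convert mem_amplitudes (bipartitePow M k)
    (isKrausFamily_piKronecker (K := fun _ => V) fun _ => hV) hrow using 1
  simp only [trace_bipartitePow_mul_kronecker]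
  rw [← norm_pow, Fintype.sum_pow]

omit [Fintype A] [Fintype B] in
theorem haagerupDual_bipartitePow (M : Matrix (A × B) (A × B) ℂ) (P : Matrix A A ℂ)
    (Q : Matrix B B ℂ) (k : ℕ) :
    haagerupDual (bipartitePow M k) (piKronecker fun _ => P) (piKronecker fun _ => Q) =
      (piKronecker fun _ : Fin k => haagerupDual M P Q).submatrix
        (Sum.elim (fun x i => Sum.inl (x.1 i, x.2 i)) fun x i => Sum.inr (x.1 i, x.2 i))
        (Sum.elim (fun x i => Sum.inl (x.1 i, x.2 i)) fun x i => Sum.inr (x.1 i, x.2 i)) := by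
  rw [haagerupDual, ← piKronecker_one, ← piKronecker_one]
  ext (x | x) (y | y) <;>
    simp [haagerupDual, realign, bipartitePow_apply, Finset.prod_mul_distrib]

theorem haagerupNorm_bipartitePow [Nonempty A] [Nonempty B] (M : Matrix (A × B) (A × B) ℂ)
    (k : ℕ) : haagerupNorm (bipartitePow M k) = haagerupNorm M ^ k := by
  apply le_antisymm
  · obtain ⟨P, Q, hdual, hP, hQ⟩ := exists_haagerupDual_posSemidef_trace_eq M
    have hle := haagerupNorm_le_of_posSemidef_haagerupDual
      (haagerupDual_bipartitePow M P Q k ▸ (posSemidef_piKronecker fun _ => hdual).submatrix _)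
    simp only [trace_piKronecker, hP, hQ, Finset.prod_const, Finset.card_univ, Fintype.card_fin,
      ← Complex.ofReal_pow, Complex.ofReal_re, add_self_div_two] at hle
    exact hle
  · have hclosed : IsClosed {p : ℝ | p ^ k ≤ haagerupNorm (bipartitePow M k)} :=
      isClosed_le (continuous_pow k) continuous_const
    exact closure_minimal
      (fun p hp => le_csSup (bddAbove_amplitudes _) (pow_mem_amplitudes hp k)) hclosed
      (csSup_mem_closure (nonempty_amplitudes M) (bddAbove_amplitudes M))

end bipartitePow

/-! ### The one-way value -/

section auxBlock

open RankOneGame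

variable {ι n : Type*} [Fintype ι] {d : ℕ}

/-- The operator `∑ₑ Rₑ ⊗ |0⟩⟨e|`. -/
def rowOperator (R : Fin (d + 1) → Matrix n n ℂ) : Matrix (n × Fin (d + 1)) (n × Fin (d + 1)) ℂ :=
  ∑ e, R e ⊗ₖ Matrix.single 0 e 1

theorem auxBlock_rowOperator (R : Fin (d + 1) → Matrix n n ℂ) (f : Fin (d + 1)) :
    auxBlock (rowOperator R) 0 f = R f := by
  ext i j
  simp [auxBlock, rowOperator, Matrix.sum_apply, Matrix.single_apply]

variable [Fintype n] [DecidableEq n]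

theorem rowOperator_mul_conjTranspose {R : Fin (d + 1) → Matrix n n ℂ}
    (hR : IsKrausFamily fun e => (R e)ᴴ) :
    rowOperator R * (rowOperator R)ᴴ = 1 ⊗ₖ Matrix.single 0 0 1 := by
  have hterm : ∀ e f, (R e ⊗ₖ Matrix.single (0 : Fin (d + 1)) e (1 : ℂ)) *
      (R f ⊗ₖ Matrix.single (0 : Fin (d + 1)) f 1)ᴴ =
      if e = f then (R e * (R f)ᴴ) ⊗ₖ Matrix.single 0 0 1 else 0 := by
    intro e f
    rw [conjTranspose_kronecker, ← mul_kronecker_mul, conjTranspose_single]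
    split_ifs with hef <;> simp [hef]
  have hrow : ∑ e, R e * (R e)ᴴ = 1 := by simpa [IsKrausFamily] using hR
  simp only [rowOperator, conjTranspose_sum, Finset.sum_mul_sum, hterm, Finset.sum_ite_eq,
    Finset.mem_univ, if_true]
  rw [← hrow]
  exact (map_sum ((kroneckerBilinear (R := ℂ)).flip (Matrix.single 0 0 1)) _ _).symm

theorem rowOperator_mul_conjTranspose_mul_self {R : Fin (d + 1) → Matrix n n ℂ}
    (hR : IsKrausFamily fun e => (R e)ᴴ) :
    rowOperator R * (rowOperator R)ᴴ * rowOperator R = rowOperator R := by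
  rw [rowOperator_mul_conjTranspose hR]
  simp [rowOperator, Finset.mul_sum, ← mul_kronecker_mul]

theorem IsKrausFamily.posSemidef_sum_norm_sq_smul_one_sub
    {S : ι → Matrix (n × Fin (d + 1)) (n × Fin (d + 1)) ℂ} (hS : IsKrausFamily S)
    (c : ι × Fin (d + 1) → ℂ) :
    ((∑ p, ‖c p‖ ^ 2) • 1 - ∑ f, (∑ p, c p • auxBlock (S p.1) p.2 f) *
      (∑ p, c p • auxBlock (S p.1) p.2 f)ᴴ).PosSemidef := by
  have h := (hS.blocks (Equiv.refl (n × Fin (d + 1)))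
    Function.injective_id).posSemidef_sum_mul_conjTranspose_sub fun p => c p • (1 : Matrix n n ℂ)
  convert h using 1
  congr 1
  · simp [Finset.sum_smul, smul_smul, Complex.conj_mul', ← Complex.ofReal_pow]
  · ext i j
    simp [auxBlock, Matrix.sum_apply, Matrix.mul_apply, Fintype.sum_prod_type_right]

end auxBlock

namespace RankOneGame

variable {A B C ι κ : Type*} [Fintype A] [Fintype B] [Fintype C] [Fintype ι] [Fintype κ]
  (G : RankOneGame A B C) {d : ℕ}

theorem sum_mul_sum_trace_auxBlock (M : Matrix (A × B) (A × B) ℂ)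
    (T : ι → Matrix (A × Fin (d + 1)) (A × Fin (d + 1)) ℂ)
    (S : κ → Matrix (B × Fin (d + 1)) (B × Fin (d + 1)) ℂ) (c : ι × κ × Fin (d + 1) → ℂ) :
    ∑ x, c x * ∑ f, (M * (auxBlock (T x.1) f 0 ⊗ₖ auxBlock (S x.2.1) x.2.2 f)).trace =
      ∑ y : ι × Fin (d + 1), (M * (auxBlock (T y.1) y.2 0 ⊗ₖ
        ∑ p : κ × Fin (d + 1), c (y.1, p) • auxBlock (S p.1) p.2 y.2)).trace := by
  have hsum : ∀ (V : Matrix A A ℂ) (w : κ × Fin (d + 1) → ℂ)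
      (R : κ × Fin (d + 1) → Matrix B B ℂ),
      (M * (V ⊗ₖ ∑ p, w p • R p)).trace = ∑ p, w p * (M * (V ⊗ₖ R p)).trace := by
    intro V w R
    rw [show V ⊗ₖ ∑ p, w p • R p = ∑ p, V ⊗ₖ (w p • R p) from
      map_sum (kroneckerBilinear (R := ℂ) V) _ _]
    simp only [kronecker_smul, Matrix.mul_sum, mul_smul_comm, trace_sum, trace_smul, smul_eq_mul]
  simp only [hsum, Finset.mul_sum]
  rw [Fintype.sum_prod_type, Fintype.sum_prod_type]
  exact Finset.sum_congr rfl fun i _ => Finset.sum_comm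

theorem nonempty_registers (G : RankOneGame A B C) : Nonempty (A × B × C) := by
  by_contra h
  rw [not_nonempty_iff] at h
  have hψ := G.norm_ψ
  rw [Subsingleton.elim G.ψ 0, norm_zero] at hψ
  exact zero_ne_one hψ

variable [DecidableEq A] [DecidableEq B]

theorem winProb_le_haagerupNorm_sq
    {T : Matrix (A × Fin (d + 1)) (A × Fin (d + 1)) ℂ →ₗ[ℂ]
      Matrix (A × Fin (d + 1)) (A × Fin (d + 1)) ℂ} (hT : IsQuantumOperation T)
    {S : Matrix (B × Fin (d + 1)) (B × Fin (d + 1)) ℂ →ₗ[ℂ]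
      Matrix (B × Fin (d + 1)) (B × Fin (d + 1)) ℂ} (hS : IsQuantumOperation S) :
    G.winProb (applyOn (registersBE A B C (Fin (d + 1))) S
        (applyOn (registersAE A B C (Fin (d + 1))) T (G.initialState d))) ≤
      haagerupNorm G.gameMatrix ^ 2 := by
  obtain ⟨K, hK, rfl⟩ := hT.exists_kraus
  obtain ⟨L, hL, rfl⟩ := hS.exists_kraus
  rw [winProb_krausMap_krausMap]
  simp only [← Fintype.sum_prod_type']
  refine sum_norm_sq_le_sq_of_forall fun c => ?_
  rw [sum_mul_sum_trace_auxBlock]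
  refine (mul_le_mul_of_nonneg_left (Complex.re_le_norm _) zero_le_two).trans ?_
  refine two_mul_norm_sum_trace_le _ zero_le_one (by positivity) ?_ ?_
  · rw [isKrausFamily_auxBlock hK 0, one_smul, sub_self]
    exact .zero
  · convert posSemidef_sum Finset.univ fun i _ =>
      hL.posSemidef_sum_norm_sq_smul_one_sub fun p => c (i, p) using 1
    simp only [Finset.sum_sub_distrib, ← Finset.sum_smul, Fintype.sum_prod_type]

theorem exists_sq_le_winProb_of_mem_amplitudes {p : ℝ} (hp : p ∈ amplitudes G.gameMatrix) :
    ∃ (d : ℕ)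
      (T : Matrix (A × Fin (d + 1)) (A × Fin (d + 1)) ℂ →ₗ[ℂ]
        Matrix (A × Fin (d + 1)) (A × Fin (d + 1)) ℂ)
      (S : Matrix (B × Fin (d + 1)) (B × Fin (d + 1)) ℂ →ₗ[ℂ]
        Matrix (B × Fin (d + 1)) (B × Fin (d + 1)) ℂ),
      IsQuantumOperation T ∧ IsQuantumOperation S ∧
        p ^ 2 ≤ G.winProb (applyOn (registersBE A B C (Fin (d + 1))) S
          (applyOn (registersAE A B C (Fin (d + 1))) T (G.initialState d))) := by
  obtain ⟨d, V, R, hV, hR, rfl⟩ := hp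
  have hS := rowOperator_mul_conjTranspose_mul_self hR
  have hT := congrArg conjTranspose <|
    rowOperator_mul_conjTranspose_mul_self (R := fun e => (V e)ᴴ) (by simpa using hV)
  set T := rowOperator fun e => (V e)ᴴ
  have hTV : ∀ f, auxBlock Tᴴ f 0 = V f := fun f => by
    rw [← conjTranspose_conjTranspose (V f), ← auxBlock_rowOperator (fun e => (V e)ᴴ) f]
    rfl
  refine ⟨d, _, _, (isKrausFamily_partialIsometry (W := Tᴴ) ?_).isQuantumOperation_krausMap,
    (isKrausFamily_partialIsometry hS).isQuantumOperation_krausMap, ?_⟩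
  · simpa [Matrix.mul_assoc] using hT
  · rw [winProb_krausMap_krausMap]
    simp only [← Fintype.sum_prod_type']
    refine le_trans (le_of_eq ?_) (Finset.single_le_sum (fun x _ => sq_nonneg _)
      (Finset.mem_univ ((0, 0, 0) : Fin 2 × Fin 2 × Fin (d + 1))))
    simp only [cons_val_zero, hTV, auxBlock_rowOperator]

theorem oneWayValue_eq_haagerupNorm_sq : G.oneWayValue = haagerupNorm G.gameMatrix ^ 2 := by
  apply le_antisymm
  · refine Real.sSup_le ?_ (sq_nonneg _)
    rintro _ ⟨d, T, S, hT, hS, rfl⟩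
    exact G.winProb_le_haagerupNorm_sq hT hS
  · have hclosed : IsClosed {p : ℝ | p ^ 2 ≤ G.oneWayValue} :=
      isClosed_le (continuous_pow 2) continuous_const
    refine closure_minimal (fun p hp => ?_) hclosed
      (csSup_mem_closure (nonempty_amplitudes _) (bddAbove_amplitudes _))
    obtain ⟨d, T, S, hT, hS, hp⟩ := G.exists_sq_le_winProb_of_mem_amplitudes hp
    refine hp.trans (le_csSup ⟨haagerupNorm G.gameMatrix ^ 2, ?_⟩ ⟨d, T, S, hT, hS, rfl⟩)
    rintro _ ⟨d, T, S, hT, hS, rfl⟩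
    exact G.winProb_le_haagerupNorm_sq hT hS

omit [DecidableEq A] [DecidableEq B] in
theorem oneWayValue_parallel (k : ℕ) : (G.parallel k).oneWayValue = G.oneWayValue ^ k := by
  classical
  obtain ⟨⟨a⟩, ⟨b⟩, -⟩ : Nonempty A ∧ Nonempty B ∧ Nonempty C := by
    simpa only [nonempty_prod] using G.nonempty_registers
  have : Nonempty A := ⟨a⟩
  have : Nonempty B := ⟨b⟩
  rw [oneWayValue_eq_haagerupNorm_sq, oneWayValue_eq_haagerupNorm_sq, gameMatrix_parallel,
    haagerupNorm_bipartitePow, pow_right_comm]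

end RankOneGame

end

theorem mainTheorem4 {A B C : Type*} [Fintype A] [Fintype B] [Fintype C]
    [DecidableEq A] [DecidableEq B] (G : RankOneGame A B C) (k : ℕ) :
    G.maximalValue = traceNorm G.gameMatrix ^ 2 ∧
    (G.parallel k).maximalValue = G.maximalValue ^ k ∧
    (G.parallel k).oneWayValue = G.oneWayValue ^ k :=
  ⟨G.maximalValue_eq_traceNorm_sq, G.maximalValue_parallel k, G.oneWayValue_parallel k⟩
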